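/- All manifolds are smooth, Hausdorff, finite-dimensional and without boundary. Let $(\bar M,g,J)$ be a Kaehler manifold: $g$ is a Riemannian metric and $J$ a smooth tensor field of type $(1,1)$ on $\bar M$ with $J^2=-I$, $g(JX,JY)=g(X,Y)$ and $\bar\nabla J=0$, where $\bar\nabla$ is the Levi-Civita connection of $g$. Let $(M_\theta,g_1)$ be a connected Riemannian manifold, $(M_T,g_2)$ a nonempty Riemannian manifold of positive dimension, and $f:M_\theta\to(0,\infty)$ a smooth function. The warped product $M=M_\theta\times_f M_T$ is the manifold $M_\theta\times M_T$ with the metric $g_1(\pi_*X,\pi_*Y)+(f\circ\pi)^2g_2(\eta_*X,\eta_*Y)$, where $\pi$ and $\eta$ are the projections to $M_\theta$ and $M_T$. Let $\varphi:M_\theta\times_f M_T\to\bar M$ be a smooth isometric immersion. An immersed submanifold $\psi:N\to\bar M$ is called - holomorphic if $J(\psi_*T_pN)\subset\psi_*T_pN$ for every $p\in N$; - pointwise slant with slant function $\theta:N\to\mathbb R$ if for every $p\in N$ and every nonzero $v\in T_pN$ the angle between $J\psi_*v$ and the subspace $\psi_*T_pN$ equals $\theta(p)$; - proper pointwise slant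 if it is pointwise slant with a slant function $\theta$ such that $\cos\theta(p)\neq0$ for every $p\in N$ (there are no totally real points). **Theorem 4.1.** Suppose that $M_T$ is holomorphic in $\bar M$, that is, $\varphi(p,\cdot):M_T\to\bar M$ is a holomorphic submanifold for every $p\in M_\theta$, and that $M_\theta$ is proper pointwise slant in $\bar M$, that is, $\varphi(\cdot,q):M_\theta\to\bar M$ is a proper pointwise slant submanifold for every $q\in M_T$. Then the warping function $f$ is constant. In other words, a Kaehler manifold admits no non-trivial warped product submanifold $M_\theta\times_f M_T$ with $M_T$ holomorphic and $M_\theta$ proper pointwise slant. -/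

import Mathlib

open Bundle Set Function
open scoped Manifold ContDiff

noncomputable section

namespace WarpedProductSlant

/-- A smooth Riemannian metric on a smooth manifold `M` without boundary, modelled on `E`. -/
abbrev RiemMetric (E : Type*) [NormedAddCommGroup E] [NormedSpace ℝ E]
    (M : Type*) [TopologicalSpace M] [ChartedSpace E M] [IsManifold 𝓘(ℝ, E) ∞ M] :=
  ContMDiffRiemannianMetric 𝓘(ℝ, E) ∞ E (TangentSpace 𝓘(ℝ, E) : M → Type _)

section Ambient

variable {E : Type*} [NormedAddCommGroup E] [NormedSpace ℝ E]
  {M : Type*} [TopologicalSpace M] [ChartedSpace E M] [IsManifold 𝓘(ℝ, E) ∞ M]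

/-- `conn` is the Levi-Civita connection of `g`: it is torsion-free and metric. In Mathlib's
argument order, `conn Y x v` is the covariant derivative of `Y` at `x` in the direction `v`. -/
structure IsLeviCivita [FiniteDimensional ℝ E] [CompleteSpace E] (g : RiemMetric E M)
    (conn : CovariantDerivative 𝓘(ℝ, E) E (TangentSpace 𝓘(ℝ, E) : M → Type _)) : Prop where
  torsion_eq_zero : conn.torsion = 0
  metric : ∀ (Y Z : Π x : M, TangentSpace 𝓘(ℝ, E) x) (x : M),
    MDiffAt (T% Y) x → MDiffAt (T% Z) x → ∀ v : TangentSpace 𝓘(ℝ, E) x,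
      (d% (fun y : M => g.inner y (Y y) (Z y)) x) v
        = g.inner x (conn Y x v) (Z x) + g.inner x (Y x) (conn Z x v)

/-- `(M, g, J)` is a Kaehler manifold: `J` is a smooth tensor field of type (1,1) with
`J ^ 2 = -1` and `g (J v, J w) = g (v, w)`, parallel for the Levi-Civita connection. -/
structure IsKaehler [FiniteDimensional ℝ E] [CompleteSpace E] (g : RiemMetric E M)
    (J : Π x : M, TangentSpace 𝓘(ℝ, E) x →L[ℝ] TangentSpace 𝓘(ℝ, E) x) : Prop where
  smooth : ContMDiff 𝓘(ℝ, E) (𝓘(ℝ, E).prod 𝓘(ℝ, E →L[ℝ] E)) ∞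
    (fun x : M => TotalSpace.mk' (E →L[ℝ] E)
      (E := fun x : M => TangentSpace 𝓘(ℝ, E) x →L[ℝ] TangentSpace 𝓘(ℝ, E) x) x (J x))
  sq_eq_neg : ∀ (x : M) (v : TangentSpace 𝓘(ℝ, E) x), J x (J x v) = -v
  hermitian : ∀ (x : M) (v w : TangentSpace 𝓘(ℝ, E) x),
    g.inner x (J x v) (J x w) = g.inner x v w
  parallel : ∃ conn : CovariantDerivative 𝓘(ℝ, E) E (TangentSpace 𝓘(ℝ, E) : M → Type _),
    IsLeviCivita g conn ∧
    ∀ (Y : Π x : M, TangentSpace 𝓘(ℝ, E) x) (x : M), MDiffAt (T% Y) x →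
      ∀ v : TangentSpace 𝓘(ℝ, E) x, conn (fun y => J y (Y y)) x v = J x (conn Y x v)

/-- The angle in `[0, π]` between two nonzero tangent vectors at `x`. -/
def angle (g : RiemMetric E M) {x : M} (u w : TangentSpace 𝓘(ℝ, E) x) : ℝ :=
  Real.arccos (g.inner x u w / (√(g.inner x u u) * √(g.inner x w w)))

/-- The angle in `[0, π / 2]` between a nonzero tangent vector `u` and a nonzero subspace `W` of
the tangent space: the smallest angle between `u` and a nonzero vector of `W`. -/
def angleToSubspace (g : RiemMetric E M) {x : M} (u : TangentSpace 𝓘(ℝ, E) x)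
    (W : Submodule ℝ (TangentSpace 𝓘(ℝ, E) x)) : ℝ :=
  sInf {t : ℝ | ∃ w ∈ W, w ≠ 0 ∧ t = angle g u w}

end Ambient

section Submanifold

variable {E : Type*} [NormedAddCommGroup E] [NormedSpace ℝ E]
  {M : Type*} [TopologicalSpace M] [ChartedSpace E M] [IsManifold 𝓘(ℝ, E) ∞ M]
  {E' : Type*} [NormedAddCommGroup E'] [NormedSpace ℝ E']
  {N : Type*} [TopologicalSpace N] [ChartedSpace E' N]

/-- The tangent space at `p` of the submanifold given by the immersion `ψ : N → M`, as a subspace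
of the tangent space of `M` at `ψ p`. -/
def tangentImage (ψ : N → M) (p : N) : Submodule ℝ (TangentSpace 𝓘(ℝ, E) (ψ p)) :=
  LinearMap.range (mfderiv 𝓘(ℝ, E') 𝓘(ℝ, E) ψ p).toLinearMap

/-- The submanifold `ψ : N → M` is holomorphic: its tangent spaces are `J`-invariant. -/
def IsHolomorphic (J : Π x : M, TangentSpace 𝓘(ℝ, E) x →L[ℝ] TangentSpace 𝓘(ℝ, E) x)
    (ψ : N → M) : Prop :=
  ∀ p : N, ∀ u ∈ tangentImage (E := E) (E' := E') ψ p,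
    J (ψ p) u ∈ tangentImage (E := E) (E' := E') ψ p

/-- The Wirtinger angle of `v`: the angle between `J v` and the tangent space of the submanifold
`ψ : N → M`, where `v` is tangent to `N` at `p`. -/
def wirtingerAngle (g : RiemMetric E M)
    (J : Π x : M, TangentSpace 𝓘(ℝ, E) x →L[ℝ] TangentSpace 𝓘(ℝ, E) x)
    (ψ : N → M) (p : N) (v : TangentSpace 𝓘(ℝ, E') p) : ℝ :=
  angleToSubspace g (J (ψ p) (mfderiv 𝓘(ℝ, E') 𝓘(ℝ, E) ψ p v))
    (tangentImage (E := E) (E' := E') ψ p)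

/-- The submanifold `ψ : N → M` is pointwise slant with slant function `θ`: at each point `p` the
Wirtinger angle of every nonzero tangent vector is `θ p`. -/
def IsPointwiseSlantWith (g : RiemMetric E M)
    (J : Π x : M, TangentSpace 𝓘(ℝ, E) x →L[ℝ] TangentSpace 𝓘(ℝ, E) x)
    (ψ : N → M) (θ : N → ℝ) : Prop :=
  ∀ (p : N) (v : TangentSpace 𝓘(ℝ, E') p), v ≠ 0 → wirtingerAngle g J ψ p v = θ p

/-- A proper pointwise slant submanifold: it is pointwise slant and has no totally real points,
i.e. no points where the cosine of the slant function vanishes. -/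
def IsProperPointwiseSlant (g : RiemMetric E M)
    (J : Π x : M, TangentSpace 𝓘(ℝ, E) x →L[ℝ] TangentSpace 𝓘(ℝ, E) x)
    (ψ : N → M) : Prop :=
  ∃ θ : N → ℝ, IsPointwiseSlantWith (E' := E') g J ψ θ ∧ ∀ p, Real.cos (θ p) ≠ 0

end Submanifold

section Warped

variable {E₁ : Type*} [NormedAddCommGroup E₁] [NormedSpace ℝ E₁]
  {B : Type*} [TopologicalSpace B] [ChartedSpace E₁ B] [IsManifold 𝓘(ℝ, E₁) ∞ B]
  {E₂ : Type*} [NormedAddCommGroup E₂] [NormedSpace ℝ E₂]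
  {F : Type*} [TopologicalSpace F] [ChartedSpace E₂ F] [IsManifold 𝓘(ℝ, E₂) ∞ F]
  {E : Type*} [NormedAddCommGroup E] [NormedSpace ℝ E]
  {M : Type*} [TopologicalSpace M] [ChartedSpace E M] [IsManifold 𝓘(ℝ, E) ∞ M]

/-- The metric of the warped product `B ×_f F`: with `π` and `η` the projections to `B` and `F`,
it is `g₁ (π_* X, π_* Y) + (f ∘ π) ^ 2 * g₂ (η_* X, η_* Y)`. -/
def warpedMetric (g₁ : RiemMetric E₁ B) (g₂ : RiemMetric E₂ F) (f : B → ℝ) (z : B × F)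
    (X Y : TangentSpace (𝓘(ℝ, E₁).prod 𝓘(ℝ, E₂)) z) : ℝ :=
  g₁.inner z.1
      (mfderiv (𝓘(ℝ, E₁).prod 𝓘(ℝ, E₂)) 𝓘(ℝ, E₁) (Prod.fst : B × F → B) z X)
      (mfderiv (𝓘(ℝ, E₁).prod 𝓘(ℝ, E₂)) 𝓘(ℝ, E₁) (Prod.fst : B × F → B) z Y)
    + f z.1 ^ 2 * g₂.inner z.2
      (mfderiv (𝓘(ℝ, E₁).prod 𝓘(ℝ, E₂)) 𝓘(ℝ, E₂) (Prod.snd : B × F → F) z X)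
      (mfderiv (𝓘(ℝ, E₁).prod 𝓘(ℝ, E₂)) 𝓘(ℝ, E₂) (Prod.snd : B × F → F) z Y)

/-- `φ` makes the warped product `B ×_f F` a submanifold of `(M, g)`: the warping function is
smooth and positive, and `φ` is a smooth isometric immersion for the warped product metric. -/
structure IsWarpedProductSubmanifold (g : RiemMetric E M) (g₁ : RiemMetric E₁ B)
    (g₂ : RiemMetric E₂ F) (f : B → ℝ) (φ : B × F → M) : Prop where
  warping_smooth : ContMDiff 𝓘(ℝ, E₁) 𝓘(ℝ, ℝ) ∞ f
  warping_pos : ∀ p, 0 < f p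
  smooth : ContMDiff (𝓘(ℝ, E₁).prod 𝓘(ℝ, E₂)) 𝓘(ℝ, E) ∞ φ
  isometric : ∀ (z : B × F) (X Y : TangentSpace (𝓘(ℝ, E₁).prod 𝓘(ℝ, E₂)) z),
    g.inner (φ z) (mfderiv (𝓘(ℝ, E₁).prod 𝓘(ℝ, E₂)) 𝓘(ℝ, E) φ z X)
        (mfderiv (𝓘(ℝ, E₁).prod 𝓘(ℝ, E₂)) 𝓘(ℝ, E) φ z Y)
      = warpedMetric g₁ g₂ f z X Y

end Warped

end WarpedProductSlant

end

/-!
The warping function is constant because the Kähler form of `M` is closed.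

Let `ω (v, w) = g (J v, w)`. Since `J` is parallel for a torsion-free metric connection, `ω` is
closed (`IsKaehler.closed`), and so is its pullback along any `C²` map into `M`
(`IsKaehler.pullback_closed`); this is used for the immersion `φ`, written in charts of `B × F`. At
each point the tangent space of the fiber is `J`-invariant and orthogonal to that of the base, so
the pullback of `ω` vanishes on mixed pairs (`inner_J_dFiber_dBase`). Evaluating `d (φ^* ω) = 0` on
one coordinate vector of the base and two of the fiber leaves a single term: the derivative, in the
direction of the base, of `ω` on two fixed vectors of the fiber. As `B` is connected,
`ω (dφ_{(p, q)} u, dφ_{(p, q)} v)`, for `u` and `v` tangent to `F` at `q`, does not depend on `p`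
(`kaehlerForm_dFiber_const`).

On the other hand `J dφ u = dφ (J_p u)` for a linear map `J_p` of `T_q F`, which is a
`g₂`-isometry because `J` is orthogonal and the metric of the fiber over `p` is `f(p)² g₂`. Hence
`f(p)² g₂ (J_p u, v)` is independent of `p` for all `v`, i.e. the vector `f(p)² J_p u` is; comparing
its length for two base points gives `f(p)⁴ = f(p')⁴` (`warping_eq`).
-/

open scoped Topology

namespace WarpedProductSlant

/-! ### Pullback of a closed two-form between vector spaces -/

theorem differentiableAt_of_clm_apply {D E F : Type*}
    [NormedAddCommGroup D] [NormedSpace ℝ D] [NormedAddCommGroup E] [NormedSpace ℝ E]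
    [NormedAddCommGroup F] [NormedSpace ℝ F] [FiniteDimensional ℝ E]
    {L : D → E →L[ℝ] F} {x : D} (h : ∀ v, DifferentiableAt ℝ (fun y => L y v) x) :
    DifferentiableAt ℝ L x := by
  let d := Module.finrank ℝ E
  have hd : d = Module.finrank ℝ (Fin d → ℝ) := (Module.finrank_fin_fun ℝ).symm
  let e₁ := ContinuousLinearEquiv.ofFinrankEq hd
  let e₂ := (e₁.arrowCongr (1 : F ≃L[ℝ] F)).trans (ContinuousLinearEquiv.piRing (Fin d))
  rw [← e₂.comp_differentiableAt_iff]
  exact differentiableAt_pi.2 fun i => h _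

set_option synthInstance.maxHeartbeats 200000 in
/-- Closedness of a two-form is preserved by pullback along a `C²` map, at a point: the terms with
second derivatives of `h` cancel in pairs because `D²h` is symmetric and `Ω` is skew. -/
theorem fderiv_pullback_cyclic_sum_eq_zero {G E : Type*}
    [NormedAddCommGroup G] [NormedSpace ℝ G] [NormedAddCommGroup E] [NormedSpace ℝ E]
    {Ω : E → E →L[ℝ] E →L[ℝ] ℝ} {h : G → E} {y₀ : G}
    (hΩ : DifferentiableAt ℝ Ω (h y₀)) (hh : ContDiffAt ℝ 2 h y₀)
    (hskew : ∀ a b, Ω (h y₀) a b = -Ω (h y₀) b a)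
    (hcl : ∀ a b c, fderiv ℝ Ω (h y₀) a b c + fderiv ℝ Ω (h y₀) b c a
      + fderiv ℝ Ω (h y₀) c a b = 0) (a b c : G) :
    (∀ b c : G, DifferentiableAt ℝ (fun y => Ω (h y) (fderiv ℝ h y b) (fderiv ℝ h y c)) y₀) ∧
    fderiv ℝ (fun y => Ω (h y) (fderiv ℝ h y b) (fderiv ℝ h y c)) y₀ a
      + fderiv ℝ (fun y => Ω (h y) (fderiv ℝ h y c) (fderiv ℝ h y a)) y₀ b
      + fderiv ℝ (fun y => Ω (h y) (fderiv ℝ h y a) (fderiv ℝ h y b)) y₀ c = 0 := by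
  have hd : HasFDerivAt (fderiv ℝ h) (fderiv ℝ (fderiv ℝ h) y₀) y₀ :=
    ((hh.fderiv_right (m := 1) le_rfl).differentiableAt one_ne_zero).hasFDerivAt
  have hsymm : ∀ u v, fderiv ℝ (fderiv ℝ h) y₀ u v = fderiv ℝ (fderiv ℝ h) y₀ v u :=
    hh.isSymmSndFDerivAt (by simp)
  have h1 : HasFDerivAt h (fderiv ℝ h y₀) y₀ :=
    (hh.differentiableAt two_ne_zero).hasFDerivAt
  have h2 : HasFDerivAt (fun y => Ω (h y)) ((fderiv ℝ Ω (h y₀)).comp (fderiv ℝ h y₀)) y₀ :=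
    HasFDerivAt.comp (g := Ω) (E := G) (F := E) (G := E →L[ℝ] E →L[ℝ] ℝ) y₀ hΩ.hasFDerivAt h1
  have key : ∀ b c : G, HasFDerivAt (fun y => Ω (h y) (fderiv ℝ h y b) (fderiv ℝ h y c)) _ y₀ :=
    fun b c => (h2.clm_apply (hd.clm_apply (hasFDerivAt_const b y₀))).clm_apply
      (hd.clm_apply (hasFDerivAt_const c y₀))
  refine ⟨fun b c => (key b c).differentiableAt, ?_⟩
  rw [(key b c).fderiv, (key c a).fderiv, (key a b).fderiv]
  have := hcl (fderiv ℝ h y₀ a) (fderiv ℝ h y₀ b) (fderiv ℝ h y₀ c)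
  simp [hsymm b a, hsymm c a, hsymm c b]
  rw [hskew (fderiv ℝ h y₀ a), hskew (fderiv ℝ h y₀ b) (fderiv ℝ (fderiv ℝ h) y₀ a c),
    hskew (fderiv ℝ h y₀ c) (fderiv ℝ (fderiv ℝ h) y₀ a b)]
  linarith

/-! ### Coordinate vector fields -/

section CoordinateFields

variable {E : Type*} [NormedAddCommGroup E] [NormedSpace ℝ E]

/-- The constant vector field `b` on the vector space `E`. -/
def constField (b : E) : Π y : E, TangentSpace 𝓘(ℝ, E) y := fun _ => b

theorem mdifferentiableAt_constField (b x : E) :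
    MDifferentiableAt 𝓘(ℝ, E) 𝓘(ℝ, E).tangent
      (fun y : E => (⟨y, constField b y⟩ : TangentBundle 𝓘(ℝ, E) E)) x :=
  (contMDiffAt_vectorSpace_iff_contDiffAt (n := 1) (V := fun _ => b).2
    contDiffAt_const).mdifferentiableAt one_ne_zero

theorem mlieBracket_constField (a b : E) :
    VectorField.mlieBracket 𝓘(ℝ, E) (constField a) (constField b) = 0 := by
  rw [← VectorField.mlieBracketWithin_univ, VectorField.mlieBracketWithin_eq_lieBracketWithin]
  ext x
  unfold constField
  simp [VectorField.lieBracketWithin]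
  rfl

variable {M : Type*} [TopologicalSpace M] [ChartedSpace E M]

/-- The coordinate vector field with constant component `b` in the preferred chart at `x₀`. It is
meaningful on the source of that chart; elsewhere the inverse of the derivative is a junk value. -/
noncomputable def coordField (x₀ : M) (b : E) : Π x : M, TangentSpace 𝓘(ℝ, E) x :=
  fun x => (mfderiv 𝓘(ℝ, E) 𝓘(ℝ, E) (extChartAt 𝓘(ℝ, E) x₀) x).inverse b

variable [IsManifold 𝓘(ℝ, E) ∞ M]

/-- The tangent space at `x₀` is identified with the model space through the preferred chart at
`x₀`, so a coordinate field takes its constant component as its value there. -/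
theorem coordField_self (x₀ : M) (b : E) : coordField x₀ b x₀ = b := by
  have h : mfderiv 𝓘(ℝ, E) 𝓘(ℝ, E) (extChartAt 𝓘(ℝ, E) x₀) x₀ = ContinuousLinearMap.id ℝ E := by
    refine (mdifferentiableAt_extChartAt (mem_chart_source E x₀)).mfderiv.trans ?_
    refine ContinuousLinearMap.ext fun v => ?_
    exact tangentCoordChange_self (I := 𝓘(ℝ, E)) (x := x₀) (v := (v : E)) (mem_extChartAt_source x₀)
  have h' := congrArg (fun L : E →L[ℝ] E => L.inverse b) h
  simp only [ContinuousLinearMap.inverse_id] at h'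
  exact h'

theorem coordField_mfderiv {x₀ x : M} (hx : x ∈ (extChartAt 𝓘(ℝ, E) x₀).source)
    (v : TangentSpace 𝓘(ℝ, E) x) :
    coordField (E := E) x₀ (mfderiv 𝓘(ℝ, E) 𝓘(ℝ, E) (extChartAt 𝓘(ℝ, E) x₀) x v) x = v := by
  obtain ⟨A, hA⟩ := isInvertible_mfderiv_extChartAt hx
  unfold coordField
  rw [← hA, ContinuousLinearMap.inverse_equiv]
  exact A.symm_apply_apply v

variable [CompleteSpace E]

theorem mdifferentiableAt_coordField (x₀ : M) (b : E) :
    MDiffAt (T% (coordField x₀ b)) x₀ :=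
  MDifferentiableAt.mpullback_vectorField (n := 2) (V := constField b)
    (mdifferentiableAt_constField b _) contMDiffAt_extChartAt
    (isInvertible_mfderiv_extChartAt (mem_extChartAt_source x₀)) le_rfl

theorem mlieBracket_coordField (x₀ : M) (a b : E) :
    VectorField.mlieBracket 𝓘(ℝ, E) (coordField x₀ a) (coordField x₀ b) x₀ = 0 := by
  have : IsManifold 𝓘(ℝ, E) 3 M := inferInstance
  have : IsManifold 𝓘(ℝ, E) (minSmoothness ℝ 3) M := by simpa
  refine (VectorField.mpullback_mlieBracket (n := 2) (V := constField a) (W := constField b)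
    (mdifferentiableAt_constField a _) (mdifferentiableAt_constField b _)
    contMDiffAt_extChartAt (by simp)).symm.trans ?_
  rw [VectorField.mpullback_apply, mlieBracket_constField]
  exact map_zero _

end CoordinateFields

/-! ### Closedness of the Kähler form -/

section KaehlerForm

variable {E : Type*} [NormedAddCommGroup E] [NormedSpace ℝ E]
  {M : Type*} [TopologicalSpace M] [ChartedSpace E M] [IsManifold 𝓘(ℝ, E) ∞ M]
  {g : RiemMetric E M}
  {J : Π x : M, TangentSpace 𝓘(ℝ, E) x →L[ℝ] TangentSpace 𝓘(ℝ, E) x}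

theorem mdifferentiableAt_inner (g : RiemMetric E M)
    {X Y : Π x : M, TangentSpace 𝓘(ℝ, E) x} {x : M}
    (hX : MDiffAt (T% X) x) (hY : MDiffAt (T% Y) x) :
    MDiffAt (fun y => g.inner y (X y) (Y y)) x := by
  have : MDifferentiableAt 𝓘(ℝ, E) (𝓘(ℝ, E).prod 𝓘(ℝ))
      (fun m ↦ TotalSpace.mk' ℝ (E := Bundle.Trivial M ℝ) m (g.inner m (X m) (Y m))) x := by
    apply MDifferentiableAt.clm_bundle_apply₂ (F₁ := E) (F₂ := E)
    · exact g.contMDiff.mdifferentiableAt (by simp)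
    · exact hX
    · exact hY
  simp only [mdifferentiableAt_totalSpace] at this
  exact this.2

/-- The Kähler form `ω (v, w) = g (J v, w)` read in the preferred chart at `x₀`, as a family of
bilinear forms on the model space. -/
noncomputable def chartKaehlerForm (g : RiemMetric E M)
    (J : Π x : M, TangentSpace 𝓘(ℝ, E) x →L[ℝ] TangentSpace 𝓘(ℝ, E) x) (x₀ : M) (y : E) :
    E →L[ℝ] E →L[ℝ] ℝ :=
  let x : M := (extChartAt 𝓘(ℝ, E) x₀).symm y
  let D : E →L[ℝ] E := (mfderiv 𝓘(ℝ, E) 𝓘(ℝ, E) (extChartAt 𝓘(ℝ, E) x₀) x).inverse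
  let G : E →L[ℝ] E →L[ℝ] ℝ := g.inner x
  let A : E →L[ℝ] E := J x
  G.bilinearComp (A.comp D) D

theorem chartKaehlerForm_apply (g : RiemMetric E M)
    (J : Π x : M, TangentSpace 𝓘(ℝ, E) x →L[ℝ] TangentSpace 𝓘(ℝ, E) x) (x₀ : M) (y b c : E) :
    chartKaehlerForm g J x₀ y b c = g.inner ((extChartAt 𝓘(ℝ, E) x₀).symm y)
      (J _ (coordField x₀ b _)) (coordField x₀ c _) := rfl

theorem chartKaehlerForm_extChartAt (g : RiemMetric E M)
    (J : Π x : M, TangentSpace 𝓘(ℝ, E) x →L[ℝ] TangentSpace 𝓘(ℝ, E) x) {x₀ x : M}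
    (hx : x ∈ (extChartAt 𝓘(ℝ, E) x₀).source) (b c : E) :
    chartKaehlerForm g J x₀ (extChartAt 𝓘(ℝ, E) x₀ x) b c
      = g.inner x (J x (coordField x₀ b x)) (coordField x₀ c x) := by
  rw [chartKaehlerForm_apply, (extChartAt 𝓘(ℝ, E) x₀).left_inv hx]

theorem chartKaehlerForm_mfderiv (g : RiemMetric E M)
    (J : Π x : M, TangentSpace 𝓘(ℝ, E) x →L[ℝ] TangentSpace 𝓘(ℝ, E) x) {x₀ x : M}
    (hx : x ∈ (extChartAt 𝓘(ℝ, E) x₀).source) (u v : TangentSpace 𝓘(ℝ, E) x) :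
    chartKaehlerForm g J x₀ (extChartAt 𝓘(ℝ, E) x₀ x)
      (mfderiv 𝓘(ℝ, E) 𝓘(ℝ, E) (extChartAt 𝓘(ℝ, E) x₀) x u)
      (mfderiv 𝓘(ℝ, E) 𝓘(ℝ, E) (extChartAt 𝓘(ℝ, E) x₀) x v) = g.inner x (J x u) v := by
  refine (chartKaehlerForm_extChartAt g J hx _ _).trans ?_
  rw [coordField_mfderiv hx, coordField_mfderiv hx]

/-- Partial derivatives in the chart at `x₀` are derivatives along coordinate fields, at `x₀`. -/
theorem differentiableAt_and_fderiv_comp_extChartAt_symm {φ : M → ℝ} {x₀ : M} (h : MDiffAt φ x₀) :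
    DifferentiableAt ℝ (fun y : E => φ ((extChartAt 𝓘(ℝ, E) x₀).symm y))
      (extChartAt 𝓘(ℝ, E) x₀ x₀) ∧
    ∀ a : E, fderiv ℝ (fun y : E => φ ((extChartAt 𝓘(ℝ, E) x₀).symm y))
      (extChartAt 𝓘(ℝ, E) x₀ x₀) a = (d% φ x₀) (coordField x₀ a x₀) := by
  constructor
  · have := h.differentiableWithinAt_writtenInExtChartAt
    simp only [modelWithCornersSelf_coe, range_id, differentiableWithinAt_univ] at this
    exact this
  · intro a
    have h' := h.mfderiv
    simp [writtenInExtChartAt] at h'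
    rw [coordField_self]
    simp [mvfderiv, h']
    rfl

variable [FiniteDimensional ℝ E] [CompleteSpace E]

theorem IsKaehler.mdifferentiableAt (h : IsKaehler g J)
    {X : Π x : M, TangentSpace 𝓘(ℝ, E) x} {x : M} (hX : MDiffAt (T% X) x) :
    MDiffAt (T% (fun y => J y (X y))) x :=
  MDifferentiableAt.clm_bundle_apply (h.smooth.mdifferentiableAt (by simp)) hX

theorem IsKaehler.inner_skew (h : IsKaehler g J)
    (x : M) (v w : TangentSpace 𝓘(ℝ, E) x) :
    g.inner x (J x v) w = -g.inner x (J x w) v := by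
  rw [← h.hermitian x (J x v) w, h.sq_eq_neg, map_neg, g.symm]
  rfl

/-- The Kähler form `ω (v, w) = g (J v, w)` is closed, evaluated on three fields that commute at
`x`. By torsion-freeness `∇_X Y = ∇_Y X` at `x`, so the six terms of the cyclic sum cancel in
pairs. -/
theorem IsKaehler.closed (h : IsKaehler g J)
    {X Y Z : Π x : M, TangentSpace 𝓘(ℝ, E) x} {x : M}
    (hX : MDiffAt (T% X) x) (hY : MDiffAt (T% Y) x) (hZ : MDiffAt (T% Z) x)
    (hXY : VectorField.mlieBracket 𝓘(ℝ, E) X Y x = 0)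
    (hYZ : VectorField.mlieBracket 𝓘(ℝ, E) Y Z x = 0)
    (hZX : VectorField.mlieBracket 𝓘(ℝ, E) Z X x = 0) :
    (d% (fun y : M => g.inner y (J y (Y y)) (Z y)) x) (X x)
      + (d% (fun y : M => g.inner y (J y (Z y)) (X y)) x) (Y x)
      + (d% (fun y : M => g.inner y (J y (X y)) (Y y)) x) (Z x) = 0 := by
  obtain ⟨conn, hLC, hJ⟩ := h.parallel
  have tor {V W : Π x : M, TangentSpace 𝓘(ℝ, E) x} (hV : MDiffAt (T% V) x)
      (hW : MDiffAt (T% W) x) : conn W x (V x) - conn V x (W x)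
        = VectorField.mlieBracket 𝓘(ℝ, E) V W x :=
    conn.torsion_eq_zero_iff.1 hLC.torsion_eq_zero hV hW
  have t1 := sub_eq_zero.1 ((tor hX hY).trans hXY)
  have t2 := sub_eq_zero.1 ((tor hY hZ).trans hYZ)
  have t3 := sub_eq_zero.1 ((tor hZ hX).trans hZX)
  rw [hLC.metric _ _ x (h.mdifferentiableAt hY) hZ, hLC.metric _ _ x (h.mdifferentiableAt hZ) hX,
    hLC.metric _ _ x (h.mdifferentiableAt hX) hY, hJ _ _ hX, hJ _ _ hY, hJ _ _ hZ, t1, t2, t3,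
    h.inner_skew x (conn X x _), h.inner_skew x (conn Y x _), h.inner_skew x (conn Z x _)]
  ring

/-- The Kähler form read in the chart at `x₀` is closed at the point corresponding to `x₀`. -/
theorem chartKaehlerForm_closed (h : IsKaehler g J) (x₀ : M) :
    DifferentiableAt ℝ (chartKaehlerForm g J x₀) (extChartAt 𝓘(ℝ, E) x₀ x₀) ∧ ∀ a b c : E,
    fderiv ℝ (chartKaehlerForm g J x₀) (extChartAt 𝓘(ℝ, E) x₀ x₀) a b c
    + fderiv ℝ (chartKaehlerForm g J x₀) (extChartAt 𝓘(ℝ, E) x₀ x₀) b c a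
    + fderiv ℝ (chartKaehlerForm g J x₀) (extChartAt 𝓘(ℝ, E) x₀ x₀) c a b = 0 := by
  have hd (b c : E) := differentiableAt_and_fderiv_comp_extChartAt_symm (mdifferentiableAt_inner g
    (h.mdifferentiableAt (mdifferentiableAt_coordField x₀ b)) (mdifferentiableAt_coordField x₀ c))
  have hD : DifferentiableAt ℝ (chartKaehlerForm g J x₀) (extChartAt 𝓘(ℝ, E) x₀ x₀) :=
    differentiableAt_of_clm_apply fun b => differentiableAt_of_clm_apply fun c => (hd b c).1
  refine ⟨hD, fun a b c => ?_⟩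
  have key (a b c : E) : fderiv ℝ (chartKaehlerForm g J x₀) (extChartAt 𝓘(ℝ, E) x₀ x₀) a b c =
      (d% (fun y : M => g.inner y (J y (coordField x₀ b y)) (coordField x₀ c y)) x₀)
        (coordField x₀ a x₀) := by
    rw [← (hd b c).2 a]
    have := ((hD.hasFDerivAt.clm_apply (hasFDerivAt_const b _)).clm_apply
      (hasFDerivAt_const c _)).fderiv
    simp only [chartKaehlerForm_apply] at this
    rw [this]
    simp
  rw [key, key, key]
  exact h.closed (mdifferentiableAt_coordField x₀ a) (mdifferentiableAt_coordField x₀ b)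
    (mdifferentiableAt_coordField x₀ c) (mlieBracket_coordField x₀ a b)
    (mlieBracket_coordField x₀ b c) (mlieBracket_coordField x₀ c a)

/-- The pullback `P` of the Kähler form along a map `k` from a vector space is closed. -/
theorem IsKaehler.pullback_closed (h : IsKaehler g J)
    {G : Type*} [NormedAddCommGroup G] [NormedSpace ℝ G] {k : G → M} {y₀ : G}
    (hk : ContMDiffAt 𝓘(ℝ, G) 𝓘(ℝ, E) 2 k y₀)
    {P : G → G → G → ℝ}
    (hP : ∀ b c y, P b c y = g.inner (k y) (J (k y) (mfderiv 𝓘(ℝ, G) 𝓘(ℝ, E) k y b))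
      (mfderiv 𝓘(ℝ, G) 𝓘(ℝ, E) k y c)) :
    (∀ b c, DifferentiableAt ℝ (P b c) y₀) ∧ ∀ a b c : G,
      fderiv ℝ (P b c) y₀ a + fderiv ℝ (P c a) y₀ b + fderiv ℝ (P a b) y₀ c = 0 := by
  have hh : ContDiffAt ℝ 2 (fun y => extChartAt 𝓘(ℝ, E) (k y₀) (k y)) y₀ :=
    contMDiffAt_iff_contDiffAt.1 (contMDiffAt_extChartAt.comp y₀ hk)
  have hev (b c : G) : P b c =ᶠ[𝓝 y₀] fun y => chartKaehlerForm g J (k y₀)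
      (extChartAt 𝓘(ℝ, E) (k y₀) (k y))
      (fderiv ℝ (fun y => extChartAt 𝓘(ℝ, E) (k y₀) (k y)) y b)
      (fderiv ℝ (fun y => extChartAt 𝓘(ℝ, E) (k y₀) (k y)) y c) := by
    filter_upwards [hk.continuousAt.preimage_mem_nhds
        (extChartAt_source_mem_nhds (I := 𝓘(ℝ, E)) (H := E) (k y₀)),
      contMDiffAt_iff_contMDiffAt_nhds (I := 𝓘(ℝ, G)) (I' := 𝓘(ℝ, E)) (by simp) |>.1 hk]
      with y hy hky
    have hd (a : G) : fderiv ℝ (fun y => extChartAt 𝓘(ℝ, E) (k y₀) (k y)) y a =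
        mfderiv 𝓘(ℝ, E) 𝓘(ℝ, E) (extChartAt 𝓘(ℝ, E) (k y₀)) (k y)
          (mfderiv 𝓘(ℝ, G) 𝓘(ℝ, E) k y a) := by
      rw [← mfderiv_eq_fderiv]
      have := mfderiv_comp y (mdifferentiableAt_extChartAt (I := 𝓘(ℝ, E)) (H := E)
        (x := k y₀) (y := k y) (by simpa using hy)) (hky.mdifferentiableAt two_ne_zero)
      exact congrArg (fun L => L a) this
    rw [hd, hd]
    exact (hP b c y).trans (chartKaehlerForm_mfderiv g J hy _ _).symm
  obtain ⟨hΩ, hcl⟩ := chartKaehlerForm_closed h (k y₀)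
  have key := fderiv_pullback_cyclic_sum_eq_zero
    (h := fun y => extChartAt 𝓘(ℝ, E) (k y₀) (k y)) hΩ hh (fun a b => by
    rw [chartKaehlerForm_extChartAt g J (mem_extChartAt_source (k y₀)),
      chartKaehlerForm_extChartAt g J (mem_extChartAt_source (k y₀))]
    exact h.inner_skew _ _ _) hcl
  refine ⟨fun b c => ((key 0 0 0).1 b c).congr_of_eventuallyEq (hev b c), fun a b c => ?_⟩
  rw [(hev b c).fderiv_eq, (hev c a).fderiv_eq, (hev a b).fderiv_eq]
  exact (key a b c).2

end KaehlerForm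

/-! ### Charts, and functions with vanishing derivative -/

section Charts

variable {E₁ : Type*} [NormedAddCommGroup E₁] [NormedSpace ℝ E₁]
  {B : Type*} [TopologicalSpace B] [ChartedSpace E₁ B] [IsManifold 𝓘(ℝ, E₁) ∞ B]

theorem contMDiffAt_extChartAt_symm_of_mem {n : ℕ∞} (p : B) {y : E₁}
    (hy : y ∈ (extChartAt 𝓘(ℝ, E₁) p).target) :
    ContMDiffAt 𝓘(ℝ, E₁) 𝓘(ℝ, E₁) n (extChartAt 𝓘(ℝ, E₁) p).symm y :=
  have : IsManifold 𝓘(ℝ, E₁) n B := .of_le (n := ∞) (by exact_mod_cast (le_top : n ≤ ⊤))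
  (contMDiffOn_extChartAt_symm p).contMDiffAt ((isOpen_extChartAt_target p).mem_nhds hy)

theorem exists_mfderiv_extChartAt_symm_eq (p : B)
    (v : TangentSpace 𝓘(ℝ, E₁) ((extChartAt 𝓘(ℝ, E₁) p).symm (extChartAt 𝓘(ℝ, E₁) p p))) :
    ∃ w : E₁, mfderiv 𝓘(ℝ, E₁) 𝓘(ℝ, E₁) (extChartAt 𝓘(ℝ, E₁) p).symm
      (extChartAt 𝓘(ℝ, E₁) p p) w = v := by
  have h := isInvertible_mfderivWithin_extChartAt_symm (I := 𝓘(ℝ, E₁)) (mem_extChartAt_target p)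
  rw [modelWithCornersSelf_coe, range_id, mfderivWithin_univ] at h
  exact h.bijective.surjective v

/-- A function on a connected manifold is constant if at every point its derivative, computed in
the preferred chart at that same point, vanishes. -/
theorem eq_of_hasFDerivAt_chart_zero [ConnectedSpace B] {H : B → ℝ}
    (hH : ∀ p, HasFDerivAt (fun y : E₁ => H ((extChartAt 𝓘(ℝ, E₁) p).symm y)) (0 : E₁ →L[ℝ] ℝ)
      (extChartAt 𝓘(ℝ, E₁) p p)) (p p' : B) : H p = H p' := by
  have hM (p : B) : HasMFDerivAt 𝓘(ℝ, E₁) 𝓘(ℝ, ℝ) H p (0 : E₁ →L[ℝ] ℝ) := by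
    refine ⟨?_, ?_⟩
    · have h1 : ContinuousAt (fun x => H ((extChartAt 𝓘(ℝ, E₁) p).symm
          (extChartAt 𝓘(ℝ, E₁) p x))) p :=
        ContinuousAt.comp (f := extChartAt 𝓘(ℝ, E₁) p) (hH p).continuousAt
          (continuousAt_extChartAt p)
      refine h1.congr ?_
      filter_upwards [extChartAt_source_mem_nhds (I := 𝓘(ℝ, E₁)) p] with x hx
      rw [(extChartAt 𝓘(ℝ, E₁) p).left_inv hx]
    · exact (hH p).hasFDerivWithinAt
  refine IsLocallyConstant.apply_eq_of_preconnectedSpace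
    ((IsLocallyConstant.iff_eventually_eq H).2 fun p => ?_) p p'
  obtain ⟨r, hr, hball⟩ := Metric.isOpen_iff.1
    (isOpen_extChartAt_target (I := 𝓘(ℝ, E₁)) p) _ (mem_extChartAt_target p)
  have hder : ∀ y ∈ Metric.ball (extChartAt 𝓘(ℝ, E₁) p p) r,
      HasFDerivAt (fun y : E₁ => H ((extChartAt 𝓘(ℝ, E₁) p).symm y)) (0 : E₁ →L[ℝ] ℝ) y := by
    intro y hy
    -- The hypothesis at the point over `y` is about another chart; use the chain rule.
    have h1 := (contMDiffAt_extChartAt_symm_of_mem (n := 1) p (hball hy)).mdifferentiableAt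
      one_ne_zero
    have h2 := ((hM _).comp y h1.hasMFDerivAt).hasFDerivAt
    refine h2.congr_fderiv ?_
    exact ContinuousLinearMap.zero_comp _
  filter_upwards [(continuousAt_extChartAt (I := 𝓘(ℝ, E₁)) p).preimage_mem_nhds
    (Metric.ball_mem_nhds _ hr), extChartAt_source_mem_nhds (I := 𝓘(ℝ, E₁)) p] with x hx hxs
  have := Metric.isOpen_ball.is_const_of_fderiv_eq_zero (𝕜 := ℝ)
    (convex_ball _ _).isPreconnected
    (fun y hy => (hder y hy).differentiableAt.differentiableWithinAt)
    (fun y hy => (hder y hy).fderiv) hx (Metric.mem_ball_self hr)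
  simpa only [(extChartAt 𝓘(ℝ, E₁) p).left_inv hxs,
    (extChartAt 𝓘(ℝ, E₁) p).left_inv (mem_extChartAt_source p)] using this

end Charts

/-! ### Geometry of the warped product -/

section WarpedProduct

variable {E₁ : Type*} [NormedAddCommGroup E₁] [NormedSpace ℝ E₁]
  {B : Type*} [TopologicalSpace B] [ChartedSpace E₁ B]
  {E₂ : Type*} [NormedAddCommGroup E₂] [NormedSpace ℝ E₂]
  {F : Type*} [TopologicalSpace F] [ChartedSpace E₂ F]
  {E : Type*} [NormedAddCommGroup E] [NormedSpace ℝ E]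
  {M : Type*} [TopologicalSpace M] [ChartedSpace E M]

/-- The differential of `φ : B × F → M` in the direction of the base. -/
noncomputable def dBase (φ : B × F → M) (z : B × F) (u : TangentSpace 𝓘(ℝ, E₁) z.1) :
    TangentSpace 𝓘(ℝ, E) (φ z) :=
  mfderiv (𝓘(ℝ, E₁).prod 𝓘(ℝ, E₂)) 𝓘(ℝ, E) φ z ((u, 0) : E₁ × E₂)

/-- The differential of `φ : B × F → M` in the direction of the fiber. -/
noncomputable def dFiber (φ : B × F → M) (z : B × F) (u : TangentSpace 𝓘(ℝ, E₂) z.2) :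
    TangentSpace 𝓘(ℝ, E) (φ z) :=
  mfderiv (𝓘(ℝ, E₁).prod 𝓘(ℝ, E₂)) 𝓘(ℝ, E) φ z ((0, u) : E₁ × E₂)

theorem mfderiv_slice {φ : B × F → M} {z : B × F}
    (hφ : MDifferentiableAt (𝓘(ℝ, E₁).prod 𝓘(ℝ, E₂)) 𝓘(ℝ, E) φ z)
    (u : TangentSpace 𝓘(ℝ, E₂) z.2) :
    mfderiv 𝓘(ℝ, E₂) 𝓘(ℝ, E) (fun q => φ (z.1, q)) z.2 u = dFiber (E₁ := E₁) φ z u := by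
  have h := mfderiv_comp (I := 𝓘(ℝ, E₂)) (I' := 𝓘(ℝ, E₁).prod 𝓘(ℝ, E₂)) (I'' := 𝓘(ℝ, E))
    (f := fun q : F => (z.1, q)) (g := φ) z.2 hφ
    (mdifferentiableAt_const.prodMk mdifferentiableAt_id)
  rw [mfderiv_prod_right] at h
  exact congrArg (fun L => L u) h

/-- The parametrization of `B × F` near `(p, q)` by the product of the preferred charts. Its source
is `E₁ × E₂` as a normed space, rather than as a product of two manifolds. -/
noncomputable def prodParam (p : B) (q : F) (y : E₁ × E₂) : B × F :=
  ((extChartAt 𝓘(ℝ, E₁) p).symm y.1, (extChartAt 𝓘(ℝ, E₂) q).symm y.2)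

variable [IsManifold 𝓘(ℝ, E₁) ∞ B] [IsManifold 𝓘(ℝ, E₂) ∞ F]

theorem contMDiffAt_prodParam {n : ℕ∞} {p : B} {q : F} {y : E₁ × E₂}
    (h₁ : y.1 ∈ (extChartAt 𝓘(ℝ, E₁) p).target) (h₂ : y.2 ∈ (extChartAt 𝓘(ℝ, E₂) q).target) :
    ContMDiffAt 𝓘(ℝ, E₁ × E₂) (𝓘(ℝ, E₁).prod 𝓘(ℝ, E₂)) n (prodParam p q) y :=
  ((contMDiffAt_extChartAt_symm_of_mem p h₁).comp y contDiffAt_fst.contMDiffAt).prodMk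
    ((contMDiffAt_extChartAt_symm_of_mem q h₂).comp y contDiffAt_snd.contMDiffAt)

theorem mfderiv_prodParam {p : B} {q : F} {y : E₁ × E₂}
    (h₁ : y.1 ∈ (extChartAt 𝓘(ℝ, E₁) p).target) (h₂ : y.2 ∈ (extChartAt 𝓘(ℝ, E₂) q).target)
    (a : E₁ × E₂) :
    mfderiv 𝓘(ℝ, E₁ × E₂) (𝓘(ℝ, E₁).prod 𝓘(ℝ, E₂)) (prodParam p q) y a =
      ((mfderiv 𝓘(ℝ, E₁) 𝓘(ℝ, E₁) (extChartAt 𝓘(ℝ, E₁) p).symm y.1 a.1,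
        mfderiv 𝓘(ℝ, E₂) 𝓘(ℝ, E₂) (extChartAt 𝓘(ℝ, E₂) q).symm y.2 a.2) : E₁ × E₂) := by
  have d₁ := ((contMDiffAt_extChartAt_symm_of_mem (n := 1) p h₁).mdifferentiableAt
    one_ne_zero).hasMFDerivAt
  have d₂ := ((contMDiffAt_extChartAt_symm_of_mem (n := 1) q h₂).mdifferentiableAt
    one_ne_zero).hasMFDerivAt
  have f₁ : HasMFDerivAt 𝓘(ℝ, E₁ × E₂) 𝓘(ℝ, E₁) (Prod.fst : E₁ × E₂ → E₁) y
    (ContinuousLinearMap.fst ℝ E₁ E₂) := hasFDerivAt_fst.hasMFDerivAt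
  have f₂ : HasMFDerivAt 𝓘(ℝ, E₁ × E₂) 𝓘(ℝ, E₂) (Prod.snd : E₁ × E₂ → E₂) y
    (ContinuousLinearMap.snd ℝ E₁ E₂) := hasFDerivAt_snd.hasMFDerivAt
  have := ((d₁.comp y f₁).prodMk (d₂.comp y f₂)).mfderiv
  exact congrArg (fun L => L a) this

variable [IsManifold 𝓘(ℝ, E) ∞ M]
  {g : RiemMetric E M} {g₁ : RiemMetric E₁ B} {g₂ : RiemMetric E₂ F} {f : B → ℝ}
  {φ : B × F → M} {J : Π x : M, TangentSpace 𝓘(ℝ, E) x →L[ℝ] TangentSpace 𝓘(ℝ, E) x}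

theorem IsWarpedProductSubmanifold.inner_dBase_dFiber
    (hφ : IsWarpedProductSubmanifold g g₁ g₂ f φ) (z : B × F)
    (u : TangentSpace 𝓘(ℝ, E₁) z.1) (w : TangentSpace 𝓘(ℝ, E₂) z.2) :
    g.inner (φ z) (dBase (E₂ := E₂) φ z u) (dFiber (E₁ := E₁) φ z w) = 0 := by
  refine (hφ.isometric z _ _).trans ?_
  unfold warpedMetric
  rw [mfderiv_fst, mfderiv_snd]
  change g₁.inner z.1 u 0 + f z.1 ^ 2 * g₂.inner z.2 0 w = 0
  simp

theorem IsWarpedProductSubmanifold.inner_dFiber_dFiber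
    (hφ : IsWarpedProductSubmanifold g g₁ g₂ f φ) (z : B × F)
    (v w : TangentSpace 𝓘(ℝ, E₂) z.2) :
    g.inner (φ z) (dFiber (E₁ := E₁) φ z v) (dFiber (E₁ := E₁) φ z w)
      = f z.1 ^ 2 * g₂.inner z.2 v w := by
  refine (hφ.isometric z _ _).trans ?_
  unfold warpedMetric
  rw [mfderiv_fst, mfderiv_snd]
  change g₁.inner z.1 0 0 + f z.1 ^ 2 * g₂.inner z.2 v w = _
  simp

/-- Holomorphy of the fibers: `J` maps `dφ u` to some `dφ w`, with `u` and `w` tangent to the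
fiber. -/
theorem exists_dFiber_eq (hφ : IsWarpedProductSubmanifold g g₁ g₂ f φ)
    (hT : ∀ p : B, IsHolomorphic (E' := E₂) J (fun q : F => φ (p, q))) (z : B × F)
    (u : TangentSpace 𝓘(ℝ, E₂) z.2) :
    ∃ w : TangentSpace 𝓘(ℝ, E₂) z.2,
      J (φ z) (dFiber (E₁ := E₁) φ z u) = dFiber (E₁ := E₁) φ z w := by
  have hd := hφ.smooth.mdifferentiableAt (x := z) (by simp)
  obtain ⟨w, hw⟩ := hT z.1 z.2 _ ⟨u, rfl⟩
  refine ⟨w, ?_⟩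
  rw [← mfderiv_slice hd, ← mfderiv_slice hd]
  exact hw.symm

/-- The pullback of the Kähler form vanishes on pairs of a vector of the fiber and one of the
base. -/
theorem inner_J_dFiber_dBase (hφ : IsWarpedProductSubmanifold g g₁ g₂ f φ)
    (hT : ∀ p : B, IsHolomorphic (E' := E₂) J (fun q : F => φ (p, q))) (z : B × F)
    (w : TangentSpace 𝓘(ℝ, E₂) z.2) (u : TangentSpace 𝓘(ℝ, E₁) z.1) :
    g.inner (φ z) (J (φ z) (dFiber (E₁ := E₁) φ z w)) (dBase (E₂ := E₂) φ z u) = 0 := by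
  obtain ⟨w', hw'⟩ := exists_dFiber_eq hφ hT z w
  rw [hw', g.symm, hφ.inner_dBase_dFiber]

variable [FiniteDimensional ℝ E] [CompleteSpace E]

/-- The Kähler form on two fixed vectors of the fiber has zero derivative in the direction of the
base. The base point of `u` and `v` is written as the image of `q` under its own chart and back, so
that the types match those of `prodParam`. -/
theorem hasFDerivAt_kaehlerForm_dFiber_zero (hM : IsKaehler g J)
    (hφ : IsWarpedProductSubmanifold g g₁ g₂ f φ)
    (hT : ∀ p : B, IsHolomorphic (E' := E₂) J (fun q : F => φ (p, q))) (p : B) (q : F)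
    (u v : TangentSpace 𝓘(ℝ, E₂) ((extChartAt 𝓘(ℝ, E₂) q).symm (extChartAt 𝓘(ℝ, E₂) q q))) :
    HasFDerivAt (fun x : E₁ =>
      g.inner (φ (prodParam p q (x, extChartAt 𝓘(ℝ, E₂) q q)))
        (J _ (dFiber (E₁ := E₁) φ (prodParam p q (x, extChartAt 𝓘(ℝ, E₂) q q)) u))
        (dFiber (E₁ := E₁) φ (prodParam p q (x, extChartAt 𝓘(ℝ, E₂) q q)) v)) (0 : E₁ →L[ℝ] ℝ)
      (extChartAt 𝓘(ℝ, E₁) p p) := by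
  obtain ⟨a, rfl⟩ := exists_mfderiv_extChartAt_symm_eq q u
  obtain ⟨b, rfl⟩ := exists_mfderiv_extChartAt_symm_eq q v
  set y₂ := extChartAt 𝓘(ℝ, E₂) q q
  set y₀ : E₁ × E₂ := (extChartAt 𝓘(ℝ, E₁) p p, y₂)
  let k : E₁ × E₂ → M := fun y => φ (prodParam p q y)
  let P : E₁ × E₂ → E₁ × E₂ → E₁ × E₂ → ℝ := fun b c y =>
    g.inner (k y) (J (k y) (mfderiv 𝓘(ℝ, E₁ × E₂) 𝓘(ℝ, E) k y b))
      (mfderiv 𝓘(ℝ, E₁ × E₂) 𝓘(ℝ, E) k y c)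
  -- `P b c` is the pullback of the Kähler form along `k`, evaluated on constant fields `b`, `c`.
  have hk₁ (y : E₁ × E₂) (h₁ : y.1 ∈ (extChartAt 𝓘(ℝ, E₁) p).target)
      (h₂ : y.2 ∈ (extChartAt 𝓘(ℝ, E₂) q).target) :
      ContMDiffAt 𝓘(ℝ, E₁ × E₂) 𝓘(ℝ, E) 2 k y :=
    ((hφ.smooth _).of_le ENat.LEInfty.out).comp y
      (contMDiffAt_prodParam (n := 2) h₁ h₂)
  have hk₂ (y : E₁ × E₂) (h₁ : y.1 ∈ (extChartAt 𝓘(ℝ, E₁) p).target)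
      (h₂ : y.2 ∈ (extChartAt 𝓘(ℝ, E₂) q).target) (c : E₁ × E₂) :
      mfderiv 𝓘(ℝ, E₁ × E₂) 𝓘(ℝ, E) k y c =
        mfderiv (𝓘(ℝ, E₁).prod 𝓘(ℝ, E₂)) 𝓘(ℝ, E) φ (prodParam p q y)
          ((mfderiv 𝓘(ℝ, E₁) 𝓘(ℝ, E₁) (extChartAt 𝓘(ℝ, E₁) p).symm y.1 c.1,
        mfderiv 𝓘(ℝ, E₂) 𝓘(ℝ, E₂) (extChartAt 𝓘(ℝ, E₂) q).symm y.2 c.2) : E₁ × E₂) := by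
    have h := mfderiv_comp y (hφ.smooth.mdifferentiableAt (x := prodParam p q y) (by simp))
      ((contMDiffAt_prodParam (n := 1) h₁ h₂).mdifferentiableAt one_ne_zero)
    refine (congrArg (fun L => L c) h).trans ?_
    exact congrArg _ (mfderiv_prodParam h₁ h₂ c)
  have hkF (y : E₁ × E₂) (h₁ : y.1 ∈ (extChartAt 𝓘(ℝ, E₁) p).target)
      (h₂ : y.2 ∈ (extChartAt 𝓘(ℝ, E₂) q).target) (c : E₂) :
      mfderiv 𝓘(ℝ, E₁ × E₂) 𝓘(ℝ, E) k y ((0, c) : E₁ × E₂) =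
        dFiber (E₁ := E₁) φ (prodParam p q y)
          (mfderiv 𝓘(ℝ, E₂) 𝓘(ℝ, E₂) (extChartAt 𝓘(ℝ, E₂) q).symm y.2 c) := by
    refine (hk₂ y h₁ h₂ _).trans (congrArg _ (Prod.ext ?_ rfl))
    exact map_zero _
  have hkB (y : E₁ × E₂) (h₁ : y.1 ∈ (extChartAt 𝓘(ℝ, E₁) p).target)
      (h₂ : y.2 ∈ (extChartAt 𝓘(ℝ, E₂) q).target) (c : E₁) :
      mfderiv 𝓘(ℝ, E₁ × E₂) 𝓘(ℝ, E) k y ((c, 0) : E₁ × E₂) =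
        dBase (E₂ := E₂) φ (prodParam p q y)
          (mfderiv 𝓘(ℝ, E₁) 𝓘(ℝ, E₁) (extChartAt 𝓘(ℝ, E₁) p).symm y.1 c) := by
    refine (hk₂ y h₁ h₂ _).trans (congrArg _ (Prod.ext rfl ?_))
    exact map_zero _
  have hev : ∀ᶠ y : E₁ × E₂ in 𝓝 y₀, y.1 ∈ (extChartAt 𝓘(ℝ, E₁) p).target ∧
      y.2 ∈ (extChartAt 𝓘(ℝ, E₂) q).target :=
    prod_mem_nhds (extChartAt_target_mem_nhds p) (extChartAt_target_mem_nhds q)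
  have hFB (c : E₂) (d : E₁) : P (0, c) (d, 0) =ᶠ[𝓝 y₀] fun _ => 0 := by
    filter_upwards [hev] with y hy
    simp only [P]
    rw [hkF y hy.1 hy.2, hkB y hy.1 hy.2]
    exact inner_J_dFiber_dBase hφ hT _ _ _
  have hBF (c : E₂) (d : E₁) : P (d, 0) (0, c) =ᶠ[𝓝 y₀] fun _ => 0 := by
    filter_upwards [hFB c d] with y hy
    simp only [P] at hy ⊢
    rw [hM.inner_skew, hy, neg_zero]
  obtain ⟨hd, hcl⟩ := hM.pullback_closed (P := P)
    (hk₁ y₀ (mem_extChartAt_target p) (mem_extChartAt_target q)) (fun _ _ _ => rfl)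
  -- Of the three terms of `d (φ^* ω)`, the two that contain a mixed pair vanish near `y₀`.
  have hzero (d : E₁) : fderiv ℝ (P (0, a) (0, b)) y₀ (d, 0) = 0 := by
    have := hcl (d, 0) (0, a) (0, b)
    rw [(hFB b d).fderiv_eq, (hBF a d).fderiv_eq] at this
    simpa using this
  have hcomp := (hd (0, a) (0, b)).hasFDerivAt.comp (extChartAt 𝓘(ℝ, E₁) p p)
    (hasFDerivAt_prodMk_left (𝕜 := ℝ) (extChartAt 𝓘(ℝ, E₁) p p) y₂)
  have hcomp' := hcomp.congr_fderiv (g' := 0) (by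
    ext d
    simpa using hzero d)
  refine hcomp'.congr_of_eventuallyEq ?_
  filter_upwards [extChartAt_target_mem_nhds (I := 𝓘(ℝ, E₁)) p] with x hx
  simp only [P, Function.comp]
  rw [hkF (x, y₂) hx (mem_extChartAt_target q), hkF (x, y₂) hx (mem_extChartAt_target q)]

/-- The Kähler form of `M`, evaluated on `dφ u` and `dφ v` with `u`, `v` tangent to the fiber, is
the same over all points of the base. -/
theorem kaehlerForm_dFiber_const [ConnectedSpace B] (hM : IsKaehler g J)
    (hφ : IsWarpedProductSubmanifold g g₁ g₂ f φ)
    (hT : ∀ p : B, IsHolomorphic (E' := E₂) J (fun q : F => φ (p, q))) (p p' : B) (q : F)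
    (u v : TangentSpace 𝓘(ℝ, E₂) q) :
    g.inner (φ (p, q)) (J _ (dFiber (E₁ := E₁) φ (p, q) u)) (dFiber (E₁ := E₁) φ (p, q) v)
      = g.inner (φ (p', q)) (J _ (dFiber (E₁ := E₁) φ (p', q) u))
        (dFiber (E₁ := E₁) φ (p', q) v) := by
  refine eq_of_hasFDerivAt_chart_zero (E₁ := E₁) (H := fun p => g.inner (φ (p, q))
    (J _ (dFiber (E₁ := E₁) φ (p, q) u)) (dFiber (E₁ := E₁) φ (p, q) v)) (fun p => ?_) p p'
  have h := hasFDerivAt_kaehlerForm_dFiber_zero hM hφ hT p q u v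
  simp only [prodParam] at h
  rw [(extChartAt 𝓘(ℝ, E₂) q).left_inv (mem_extChartAt_source q)] at h
  exact h

/-- With `J dφ u = dφ w` over `p` and `J dφ u = dφ w'` over `p'`, the vectors `f(p)² w` and
`f(p')² w'` agree and `w`, `w'` have the length of `u`, whence `f(p)⁴ = f(p')⁴`. -/
theorem warping_eq [ConnectedSpace B] [Nontrivial E₂] [Nonempty F] (hM : IsKaehler g J)
    (hφ : IsWarpedProductSubmanifold g g₁ g₂ f φ)
    (hT : ∀ p : B, IsHolomorphic (E' := E₂) J (fun q : F => φ (p, q))) (p p' : B) :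
    f p = f p' := by
  obtain ⟨q⟩ := ‹Nonempty F›
  obtain ⟨u, hu⟩ : ∃ u : TangentSpace 𝓘(ℝ, E₂) q, u ≠ 0 := exists_ne (0 : E₂)
  obtain ⟨w, hw⟩ := exists_dFiber_eq hφ hT (p, q) u
  obtain ⟨w', hw'⟩ := exists_dFiber_eq hφ hT (p', q) u
  have norm_eq (p : B) (w : TangentSpace 𝓘(ℝ, E₂) q)
      (hw : J (φ (p, q)) (dFiber (E₁ := E₁) φ (p, q) u) = dFiber (E₁ := E₁) φ (p, q) w) :
      g₂.inner q w w = g₂.inner q u u := by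
    have h := hM.hermitian (φ (p, q)) (dFiber (E₁ := E₁) φ (p, q) u)
      (dFiber (E₁ := E₁) φ (p, q) u)
    rw [hw, hφ.inner_dFiber_dFiber, hφ.inner_dFiber_dFiber] at h
    exact mul_left_cancel₀ (pow_ne_zero 2 (hφ.warping_pos p).ne') h
  have pair_eq (v : TangentSpace 𝓘(ℝ, E₂) q) :
      f p ^ 2 * g₂.inner q w v = f p' ^ 2 * g₂.inner q w' v := by
    have h := kaehlerForm_dFiber_const hM hφ hT p p' q u v
    rw [hw, hw', hφ.inner_dFiber_dFiber, hφ.inner_dFiber_dFiber] at h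
    exact h
  have h₁ := pair_eq w
  have h₂ := pair_eq w'
  rw [norm_eq p w hw] at h₁
  rw [norm_eq p' w' hw', g₂.symm q w w'] at h₂
  have hpos := g₂.pos q u hu
  have h4 : f p ^ 4 * g₂.inner q u u = f p' ^ 4 * g₂.inner q u u := by
    linear_combination f p ^ 2 * h₁ + f p' ^ 2 * h₂
  exact (pow_left_inj₀ (hφ.warping_pos p).le (hφ.warping_pos p').le four_ne_zero).1
    (mul_right_cancel₀ hpos.ne' h4)

end WarpedProduct

end WarpedProductSlant

theorem theorem4p1
    -- the ambient Kaehler manifold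
    {E : Type*} [NormedAddCommGroup E] [NormedSpace ℝ E] [FiniteDimensional ℝ E] [CompleteSpace E]
    {M : Type*} [TopologicalSpace M] [T2Space M] [ChartedSpace E M] [IsManifold 𝓘(ℝ, E) ∞ M]
    (g : WarpedProductSlant.RiemMetric E M)
    (J : Π x : M, TangentSpace 𝓘(ℝ, E) x →L[ℝ] TangentSpace 𝓘(ℝ, E) x)
    (hM : WarpedProductSlant.IsKaehler g J)
    -- the base of the warped product, a connected Riemannian manifold
    {E₁ : Type*} [NormedAddCommGroup E₁] [NormedSpace ℝ E₁] [FiniteDimensional ℝ E₁]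
    {B : Type*} [TopologicalSpace B] [T2Space B] [ConnectedSpace B] [ChartedSpace E₁ B]
    [IsManifold 𝓘(ℝ, E₁) ∞ B] (g₁ : WarpedProductSlant.RiemMetric E₁ B)
    -- the fiber, a nonempty Riemannian manifold of positive dimension
    {E₂ : Type*} [NormedAddCommGroup E₂] [NormedSpace ℝ E₂] [FiniteDimensional ℝ E₂]
    [Nontrivial E₂]
    {F : Type*} [TopologicalSpace F] [T2Space F] [Nonempty F] [ChartedSpace E₂ F]
    [IsManifold 𝓘(ℝ, E₂) ∞ F] (g₂ : WarpedProductSlant.RiemMetric E₂ F)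
    -- the warped product submanifold
    (f : B → ℝ) (φ : B × F → M)
    (hφ : WarpedProductSlant.IsWarpedProductSubmanifold g g₁ g₂ f φ)
    (hT : ∀ p : B, WarpedProductSlant.IsHolomorphic (E' := E₂) J (fun q : F => φ (p, q)))
    (hθ : ∀ q : F, WarpedProductSlant.IsProperPointwiseSlant (E' := E₁) g J
      (fun p : B => φ (p, q))) :
    ∃ c : ℝ, ∀ p : B, f p = c := by
  obtain ⟨p₀⟩ : Nonempty B := inferInstance
  exact ⟨f p₀, fun p => WarpedProductSlant.warping_eq hM hφ hT p p₀⟩
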